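/- A curve in a topological space is a continuous map from a compact interval. Let $(X,d_X)$ and $(Y,d_Y)$ be metric spaces. Assume that $X$ is $C$-quasi-convex for some $C\in\mathbb{R}$, i.e. any two points $x,x'\in X$ are connected by a curve of length at most $C\,d_X(x,x')$, and that $H_1(X)=0$ or $H_1^{\mathrm{Lip}}(X)=0$, where $H_1$ is singular homology with integer coefficients and $H_1^{\mathrm{Lip}}$ is the homology of the subcomplex generated by the singular simplices that are Lipschitz maps. Let $\sigma:[0,\infty)\to[0,\infty)$ be continuous and strictly increasing with $\sigma(0)=0$, and let $\varphi:X\to Y$ satisfy $d_Y(\varphi(x),\varphi(x'))\le\sigma(d_X(x,x'))$ for all $x,x'\in X$. Assume that $\varphi$ has Property (T): for all $x,x'\in X$ with $\varphi(x)\ne\varphi(x')$ there is a point $y\in Y\setminus\{\varphi(x),\varphi(x')\}$ such that $y\in\operatorname{im}(\varphi\circ\gamma)$ for every curve $\gamma:[0,1]\to X$ connecting $x$ with $x'$. For $x,x'\in X$ put \[ D(x,x') = \inf\{\operatorname{diam}(\varphi(A)) : A\subset X \text{ connected},\ x,x'\in A\}, \] let $x\sim x'$ if and only if $D(x,x')=0$,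 and let $T=X/{\sim}$. Proposition. $D([x],[x']) = D(x,x')$ is a well-defined (finite) metric on $T$, and $(T,D)$ is a tree. That is, any two different points $p,p'\in T$ are connected by an embedding $\gamma:[0,1]\to T$ with $\gamma(0)=p$ and $\gamma(1)=p'$, and if $\gamma_1,\gamma_2:[0,1]\to T$ are two injective curves with $\gamma_1(0)=\gamma_2(0)$ and $\gamma_1(1)=\gamma_2(1)$, then they are reparametrizations of each other: $\gamma_1=\gamma_2\circ\tau$ for some increasing homeomorphism $\tau$ of $[0,1]$. -/

import Mathlib

open Set Topology CategoryTheory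
open scoped ENNReal NNReal

universe u v

namespace FactorTree

/-! ### Quasi-convexity, `σ`-continuity and Property (T) -/

/-- `X` is `C`-quasi-convex: any two points are joined by a curve of length at most `C d(x,x')`. -/
def IsQuasiConvex (C : ℝ) (X : Type u) [MetricSpace X] : Prop :=
  ∀ x x' : X, ∃ γ : Path x x', eVariationOn γ univ ≤ ENNReal.ofReal (C * dist x x')

/-- A modulus of continuity: a continuous, strictly increasing function
`[0,∞) → [0,∞)` vanishing at `0`. -/
structure IsModulus (σ : ℝ≥0 → ℝ≥0) : Prop where
  continuous : Continuous σ
  strictMono : StrictMono σ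
  map_zero : σ 0 = 0

/-- `φ` is `σ`-continuous. -/
def IsSigmaContinuous (σ : ℝ≥0 → ℝ≥0) {X : Type u} {Y : Type v} [MetricSpace X] [MetricSpace Y]
    (φ : X → Y) : Prop :=
  ∀ x x' : X, nndist (φ x) (φ x') ≤ σ (nndist x x')

/-- Property (T): if `φ x ≠ φ x'`, there is a point `y` different from `φ x` and `φ x'` that lies
on `φ ∘ γ` for every curve `γ` from `x` to `x'`. -/
def PropertyT {X : Type u} {Y : Type v} [TopologicalSpace X] (φ : X → Y) : Prop :=
  ∀ x x' : X, φ x ≠ φ x' →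
    ∃ y : Y, y ≠ φ x ∧ y ≠ φ x' ∧ ∀ γ : Path x x', y ∈ range (φ ∘ γ)

/-! ### Singular homology and singular Lipschitz homology -/

/-- `H₁(X) = 0`: the first singular homology group with integer coefficients vanishes. -/
def SingularH1Vanishes (X : Type u) [TopologicalSpace X] : Prop :=
  Limits.IsZero
    (((AlgebraicTopology.singularHomologyFunctor AddCommGrpCat.{u} 1).obj
      (AddCommGrpCat.of (ULift.{u} ℤ))).obj (TopCat.of X))

/-- The affine map between standard simplices induced by a map of vertices is Lipschitz. -/
theorem lipschitzWith_stdSimplex_map {m n : ℕ} (f : Fin m → Fin n) :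
    LipschitzWith (m : ℝ≥0) (stdSimplex.map (S := ℝ) f) := by
  classical
  refine LipschitzWith.of_dist_le_mul fun s t => ?_
  rw [Subtype.dist_eq, dist_pi_le_iff (by positivity)]
  intro j
  have h : ∀ r : stdSimplex ℝ (Fin m), (stdSimplex.map f r).val j =
      ∑ i with f i = j, r.val i := by
    intro r
    exact FunOnFinite.linearMap_apply_apply ℝ ℝ f r.val j
  rw [h, h, Real.dist_eq, ← Finset.sum_sub_distrib]
  refine (Finset.abs_sum_le_sum_abs _ _).trans ?_
  refine (Finset.sum_le_card_nsmul _ _ (dist s t) fun i _ => ?_).trans ?_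
  · rw [← Real.dist_eq]
    exact dist_le_pi_dist s.val t.val i
  · rw [nsmul_eq_mul]
    refine mul_le_mul_of_nonneg_right ?_ dist_nonneg
    have := Finset.card_filter_le (Finset.univ : Finset (Fin m)) (fun i => f i = j)
    rw [Finset.card_univ, Fintype.card_fin] at this
    exact_mod_cast this

/-- The singular Lipschitz simplices `Δⁿ → X`, as a simplicial subset of the singular simplicial
set of `X`. (Here `Δⁿ` carries the sup metric of `ℝⁿ⁺¹`, which is bi-Lipschitz equivalent to the
Euclidean metric.) -/
noncomputable def lipschitzSingularSet (X : Type u) [MetricSpace X] :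
    (TopCat.toSSet.obj (TopCat.of X)).Subcomplex where
  obj n := {s | ∃ K : ℝ≥0, LipschitzWith K (fun z => ((TopCat.of X).toSSetObjEquiv n s z : X))}
  map {U V} i s hs := by
    obtain ⟨K, hK⟩ := hs
    exact ⟨_, hK.comp (lipschitzWith_stdSimplex_map i.unop)⟩

/-- `H₁^Lip(X) = 0`: the first singular Lipschitz homology group with integer coefficients
vanishes. -/
def LipschitzH1Vanishes (X : Type u) [MetricSpace X] : Prop :=
  Limits.IsZero
    ((lipschitzSingularSet X).toSSet.homology (AddCommGrpCat.of (ULift.{u} ℤ)) 1)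

/-! ### The pseudo-metric `D` and the quotient `T` -/

section Quotient

variable {X : Type u} {Y : Type v} [TopologicalSpace X] [PseudoEMetricSpace Y]

/-- `D(x,x')` is the infimum of `diam φ(C)` over all connected `C ⊆ X` containing `x` and `x'`.
The value is an extended nonnegative real, so that unbounded images and an empty family of sets
contribute `∞`. -/
noncomputable def treeDist (φ : X → Y) (x x' : X) : ℝ≥0∞ :=
  ⨅ (C : Set X) (_ : IsConnected C ∧ x ∈ C ∧ x' ∈ C), Metric.ediam (φ '' C)

theorem treeDist_self (φ : X → Y) (x : X) : treeDist φ x x = 0 := by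
  refine le_antisymm ((iInf₂_le {x} ⟨isConnected_singleton, rfl, rfl⟩).trans ?_) bot_le
  simp

theorem treeDist_comm (φ : X → Y) (x x' : X) : treeDist φ x x' = treeDist φ x' x := by
  unfold treeDist
  congr! 4
  tauto

theorem treeDist_triangle (φ : X → Y) (x y z : X) :
    treeDist φ x z ≤ treeDist φ x y + treeDist φ y z := by
  simp only [treeDist, ENNReal.iInf_add, ENNReal.add_iInf]
  refine le_iInf₂ fun B hB => le_iInf₂ fun A hA => ?_
  have hy : (φ '' A ∩ φ '' B).Nonempty :=
    ⟨φ y, mem_image_of_mem _ hA.2.2, mem_image_of_mem _ hB.2.1⟩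
  refine (iInf₂_le (A ∪ B) ⟨IsConnected.union ⟨y, hA.2.2, hB.2.1⟩ hA.1 hB.1,
    Or.inl hA.2.1, Or.inr hB.2.2⟩).trans ?_
  rw [image_union]
  exact Metric.ediam_union_le hy

/-- `x ∼ x'` iff `D(x,x') = 0`. -/
def treeSetoid (φ : X → Y) : Setoid X where
  r x x' := treeDist φ x x' = 0
  iseqv :=
    { refl := treeDist_self φ
      symm := fun {x x'} h => (treeDist_comm φ x' x).trans h
      trans := fun {x y z} h h' =>
        le_antisymm ((treeDist_triangle φ x y z).trans (by rw [h, h', add_zero])) bot_le }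

/-- The quotient `T = X/∼`. -/
def TreeQuotient (φ : X → Y) : Type u :=
  Quotient (treeSetoid φ)

/-- The quotient map `ψ : X → T`. -/
def treeProj (φ : X → Y) (x : X) : TreeQuotient φ :=
  Quotient.mk (treeSetoid φ) x

end Quotient

/-! ### Trees -/

/-- A metric space is a tree if it is uniquely arc-connected: any two different points are joined
by an embedded curve, and any two injective curves with the same endpoints are reparametrizations
of each other (order automorphisms of `[0,1]` are the increasing homeomorphisms of `[0,1]`). -/
structure IsTree (T : Type u) [MetricSpace T] : Prop where
  exists_arc : ∀ p q : T, p ≠ q → ∃ γ : Path p q, IsEmbedding γ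
  unique_arc : ∀ γ₁ γ₂ : C(unitInterval, T), Function.Injective γ₁ → Function.Injective γ₂ →
    γ₁ 0 = γ₂ 0 → γ₁ 1 = γ₂ 1 → ∃ τ : unitInterval ≃o unitInterval, ∀ t, γ₁ t = γ₂ (τ t)

end FactorTree

namespace FactorTree

open scoped Simplicial in
/-- If the first homology of a simplicial set vanishes, a real valued `1`-cocycle vanishes on
triangles. -/
theorem cocycle_add_of_isZero_homology (S : SSet.{u})
    (h : Limits.IsZero (S.homology (AddCommGrpCat.of (ULift.{u} ℤ)) 1))
    (c : S _⦋1⦌ → ℝ) (hc : ∀ t : S _⦋2⦌, c (S.δ 1 t) = c (S.δ 0 t) + c (S.δ 2 t))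
    {a b e : S _⦋1⦌} (h1 : S.δ 1 a = S.δ 1 e) (h2 : S.δ 0 a = S.δ 1 b) (h3 : S.δ 0 b = S.δ 0 e) :
    c e = c a + c b := by
  let R : AddCommGrpCat.{u} := AddCommGrpCat.of (ULift.{u} ℤ)
  let A : AddCommGrpCat.{u} := AddCommGrpCat.of (ULift.{u} ℝ)
  let m : ℝ → (R ⟶ A) := fun r => AddCommGrpCat.ofHom
    (AddMonoidHom.mk' (fun n : ULift.{u} ℤ => (⟨n.down * r⟩ : ULift.{u} ℝ)) (by
      intro x y; simp [add_mul, ULift.ext_iff]))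
  have madd : ∀ r s, m (r + s) = m r + m s := by
    intro r s; ext x; simp [m, mul_add]
  have minj : ∀ r, m r = 0 → r = 0 := by
    intro r hr
    have := congrArg (fun f : R ⟶ A => (f.hom (⟨1⟩ : ULift.{u} ℤ)).down) hr
    simpa [m] using this
  let K := S.chainComplex R
  let β : K.X 1 ⟶ A := Limits.Cofan.IsColimit.desc (S.isColimitChainComplexXCofan R 1)
    (fun s => m (c s))
  have hβ : ∀ s, S.ιChainComplex s ≫ β = m (c s) := fun s =>
    Limits.Cofan.IsColimit.fac (S.isColimitChainComplexXCofan R 1) (fun s => m (c s)) s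
  have hex : (K.sc' 2 1 0).Exact := by
    rw [← HomologicalComplex.exactAt_iff' K 2 1 0 (by simp) (by simp)]
    exact (HomologicalComplex.exactAt_iff_isZero_homology K 1).2 h
  have hd : K.d 2 1 ≫ β = 0 := by
    refine SSet.chainComplex_hom_ext fun t => ?_
    rw [← Category.assoc, SSet.ιChainComplex_d]
    simp [Fin.sum_univ_three, Preadditive.add_comp, hβ, hc, madd]
  let z : R ⟶ K.X 1 := S.ιChainComplex a + S.ιChainComplex b - S.ιChainComplex e
  have hz : z ≫ K.d 1 0 = 0 := by
    simp [z, K, Preadditive.add_comp, Preadditive.sub_comp, SSet.ιChainComplex_d, Fin.sum_univ_two,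
      h1, h2, h3]
    abel
  have key : z ≫ β = 0 := hex.comp_eq_zero hz hd
  have : m (c a) + m (c b) = m (c e) := by
    simpa [z, Preadditive.add_comp, Preadditive.sub_comp, hβ, sub_eq_zero] using key
  have m0 : m 0 = 0 := by have := madd 0 0; simpa using this
  have h4 : m (c a + c b + - c e) = 0 := by
    rw [madd, madd, this, ← madd, add_neg_cancel, m0]
  linarith [minj _ h4]

instance contractibleSpace_stdSimplex (n : ℕ) :
    ContractibleSpace (stdSimplex ℝ (Fin (n + 1))) :=
  (convex_stdSimplex ℝ (Fin (n + 1))).contractibleSpace ⟨_, single_mem_stdSimplex ℝ 0⟩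

instance locallyPathConnectedSpace_stdSimplex (n : ℕ) :
    LocallyPathConnectedSpace (stdSimplex ℝ (Fin (n + 1))) := by
  refine LocallyPathConnectedSpace.of_bases (fun x => Metric.nhds_basis_ball) fun x r hr => ?_
  rw [IsInducing.subtypeVal.isPathConnected_iff]
  have : Subtype.val '' (Metric.ball x r) = stdSimplex ℝ (Fin (n + 1)) ∩ Metric.ball x.1 r := by
    ext y
    simp only [mem_image, Metric.mem_ball, Subtype.exists, mem_inter_iff]
    exact ⟨fun ⟨z, hz, h, e⟩ => e ▸ ⟨hz, h⟩, fun ⟨h, h'⟩ => ⟨y, h, h', rfl⟩⟩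
  rw [this]
  exact ((convex_stdSimplex ℝ _).inter (convex_ball _ _)).isPathConnected
    ⟨x.1, x.2, Metric.mem_ball_self hr⟩

/-- Maps from a simplex to the circle lift to the real line. -/
theorem exists_lift_stdSimplex {n : ℕ} (f : C(stdSimplex ℝ (Fin (n + 1)), AddCircle (1 : ℝ))) :
    ∃ F : C(stdSimplex ℝ (Fin (n + 1)), ℝ), ∀ z, (F z : AddCircle (1 : ℝ)) = f z := by
  obtain ⟨r, hr⟩ := QuotientAddGroup.mk_surjective (f (stdSimplex.vertex 0))
  obtain ⟨F, hF, -⟩ := (AddCircle.isCoveringMap_coe (1 : ℝ)).existsUnique_continuousMap_lifts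
    f (stdSimplex.vertex 0) r hr
  exact ⟨F, fun z => congrFun hF.2 z⟩

/-- Lifts of the same circle valued map on a connected space have the same increments. -/
theorem sub_eq_sub_of_coe_eq {A : Type*} [TopologicalSpace A] [PreconnectedSpace A] {F G : A → ℝ}
    (hF : Continuous F) (hG : Continuous G)
    (h : ∀ z, (F z : AddCircle (1 : ℝ)) = G z) (z w : A) : F z - F w = G z - G w := by
  have key : (fun z => F z) = fun z => G z + (F w - G w) := by
    refine (AddCircle.isCoveringMap_coe (1 : ℝ)).eq_of_comp_eq hF (by fun_prop) ?_ w (by simp)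
    funext z
    simp [h]
  have := congrFun key z
  linarith

/-- The increment along a `1`-simplex of a lift of a circle valued map. -/
noncomputable def increment (f : C(stdSimplex ℝ (Fin 2), AddCircle (1 : ℝ))) : ℝ :=
  (exists_lift_stdSimplex f).choose (stdSimplex.vertex 1) -
    (exists_lift_stdSimplex f).choose (stdSimplex.vertex 0)

theorem increment_eq {f : C(stdSimplex ℝ (Fin 2), AddCircle (1 : ℝ))}
    {F : stdSimplex ℝ (Fin 2) → ℝ} (hF : Continuous F)
    (h : ∀ z, (F z : AddCircle (1 : ℝ)) = f z) :
    increment f = F (stdSimplex.vertex 1) - F (stdSimplex.vertex 0) :=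
  sub_eq_sub_of_coe_eq (ContinuousMap.continuous _) hF
    (fun z => ((exists_lift_stdSimplex f).choose_spec z).trans (h z).symm) _ _

theorem abs_increment_lt {f : C(stdSimplex ℝ (Fin 2), AddCircle (1 : ℝ))} {ε : ℝ}
    (hε0 : 0 < ε) (hε : ε ≤ 1 / 2) (h : ∀ z, ‖f z - f (stdSimplex.vertex 0)‖ < ε) :
    |increment f| < ε := by
  obtain ⟨F, hF⟩ := exists_lift_stdSimplex f
  rw [increment_eq F.continuous hF]
  set v : stdSimplex ℝ (Fin 2) := stdSimplex.vertex 0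
  have heq : {z | |F z - F v| < ε} = {z | |F z - F v| ≤ 1 / 2} := by
    ext z
    refine ⟨fun hz => (le_of_lt hz).trans hε, fun hz => ?_⟩
    have h1 := h z
    rw [← hF z, ← hF v, ← AddCircle.coe_sub,
      (AddCircle.norm_coe_eq_abs_iff (p := 1) one_ne_zero).2 (by simpa using hz)] at h1
    exact h1
  have hclopen : IsClopen {z | |F z - F v| < ε} := by
    refine ⟨heq ▸ isClosed_le (by fun_prop) (by fun_prop), isOpen_lt (by fun_prop) (by fun_prop)⟩
  have huniv := hclopen.eq_univ ⟨v, by simpa using hε0⟩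
  have : stdSimplex.vertex 1 ∈ {z | |F z - F v| < ε} := by rw [huniv]; trivial
  exact this

section Lifting

open scoped Simplicial

variable {X : Type u} [TopologicalSpace X] {S : SSet.{u}}
  (ι : S ⟶ TopCat.toSSet.obj (TopCat.of X))

/-- The singular simplex underlying a simplex of a simplicial set over the singular set. -/
noncomputable def toSimplexMap {n : ℕ} (s : S _⦋n⦌) : C(stdSimplex ℝ (Fin (n + 1)), X) :=
  (TopCat.of X).toSSetObjEquiv _ (ι.app _ s)

theorem toSimplexMap_δ {n : ℕ} (s : S _⦋n + 1⦌) (i : Fin (n + 2))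
    (z : stdSimplex ℝ (Fin (n + 1))) :
    toSimplexMap ι (S.δ i s) z = toSimplexMap ι s (stdSimplex.map i.succAbove z) := by
  have h : ι.app _ (S.δ i s) = (TopCat.toSSet.obj (TopCat.of X)).δ i (ι.app _ s) :=
    ConcreteCategory.congr_hom (ι.naturality (SimplexCategory.δ i).op) s
  unfold toSimplexMap
  rw [h]
  rfl

theorem toSimplexMap_zero_injective (hι : Function.Injective (ι.app (.op ⦋0⦌))) {s t : S _⦋0⦌}
    (h : toSimplexMap ι s (stdSimplex.vertex 0) = toSimplexMap ι t (stdSimplex.vertex 0)) :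
    s = t := by
  apply hι
  apply ((TopCat.of X).toSSetObjEquiv _).injective
  ext z
  have hz : z = (stdSimplex.vertex 0 : stdSimplex ℝ (Fin 1)) := Subsingleton.elim _ _
  rw [hz]
  exact h

/-- A `1`-simplex of `S` runs from `x` to `y` inside `U`. -/
def JoinedBySimplex (U : Set X) (x y : X) : Prop :=
  ∃ s : S _⦋1⦌, toSimplexMap ι s (stdSimplex.vertex 0) = x ∧
    toSimplexMap ι s (stdSimplex.vertex 1) = y ∧ ∀ z, toSimplexMap ι s z ∈ U

/-- If the first homology of a simplicial set of singular simplices vanishes, and nearby points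
are joined by small `1`-simplices, then circle valued maps lift to the real line. -/
theorem exists_lift_of_isZero_homology [Nonempty X]
    (hι : Function.Injective (ι.app (.op ⦋0⦌)))
    (h : Limits.IsZero (S.homology (AddCommGrpCat.of (ULift.{u} ℤ)) 1))
    (hjoin : ∀ x y, JoinedBySimplex ι univ x y)
    (hloc : ∀ x, ∀ U ∈ 𝓝 x, ∀ᶠ y in 𝓝 x, JoinedBySimplex ι U x y)
    (f : C(X, AddCircle (1 : ℝ))) :
    ∃ F : C(X, ℝ), ∀ x, (F x : AddCircle (1 : ℝ)) = f x := by
  let c : S _⦋1⦌ → ℝ := fun s => increment (f.comp (toSimplexMap ι s))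
  have hc : ∀ t : S _⦋2⦌, c (S.δ 1 t) = c (S.δ 0 t) + c (S.δ 2 t) := by
    intro t
    obtain ⟨G, hG⟩ := exists_lift_stdSimplex (f.comp (toSimplexMap ι t))
    have hface : ∀ i : Fin 3, c (S.δ i t) =
        G (stdSimplex.vertex (i.succAbove 1)) - G (stdSimplex.vertex (i.succAbove 0)) := by
      intro i
      have := increment_eq (f := f.comp (toSimplexMap ι (S.δ i t)))
        (F := fun z => G (stdSimplex.map i.succAbove z))
        (G.continuous.comp (stdSimplex.continuous_map _)) (fun z => by
          rw [hG]
          simp only [ContinuousMap.comp_apply]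
          rw [toSimplexMap_δ])
      simpa only [stdSimplex.map_vertex] using this
    rw [hface, hface, hface]
    simp only [show (0 : Fin 3).succAbove (1 : Fin 2) = 2 from rfl,
      show (0 : Fin 3).succAbove (0 : Fin 2) = 1 from rfl,
      show (1 : Fin 3).succAbove (1 : Fin 2) = 2 from rfl,
      show (1 : Fin 3).succAbove (0 : Fin 2) = 0 from rfl,
      show (2 : Fin 3).succAbove (1 : Fin 2) = 1 from rfl,
      show (2 : Fin 3).succAbove (0 : Fin 2) = 0 from rfl]
    ring
  have h0 : ∀ s : S _⦋1⦌, toSimplexMap ι (S.δ 0 s) (stdSimplex.vertex 0) =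
      toSimplexMap ι s (stdSimplex.vertex 1) := by
    intro s
    rw [toSimplexMap_δ, stdSimplex.map_vertex]
    rfl
  have h1 : ∀ s : S _⦋1⦌, toSimplexMap ι (S.δ 1 s) (stdSimplex.vertex 0) =
      toSimplexMap ι s (stdSimplex.vertex 0) := by
    intro s
    rw [toSimplexMap_δ, stdSimplex.map_vertex]
    rfl
  obtain ⟨x₀⟩ := ‹Nonempty X›
  obtain ⟨r₀, hr₀⟩ := QuotientAddGroup.mk_surjective (f x₀)
  choose s hs0 hs1 _ using hjoin x₀
  have hcoe : ∀ t : S _⦋1⦌, (c t : AddCircle (1 : ℝ)) =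
      f (toSimplexMap ι t (stdSimplex.vertex 1)) - f (toSimplexMap ι t (stdSimplex.vertex 0)) := by
    intro t
    obtain ⟨G, hG⟩ := exists_lift_stdSimplex (f.comp (toSimplexMap ι t))
    have : c t = _ := increment_eq G.continuous hG
    rw [this, AddCircle.coe_sub, hG, hG]
    rfl
  refine ⟨⟨fun x => r₀ + c (s x), ?_⟩, fun x => ?_⟩
  · rw [continuous_iff_continuousAt]
    intro x
    rw [ContinuousAt, Metric.tendsto_nhds]
    intro ε hε
    have hU : {y | ‖f y - f x‖ < min ε (1 / 2)} ∈ 𝓝 x :=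
      (isOpen_lt (by fun_prop) continuous_const).mem_nhds (by simp [hε])
    filter_upwards [hloc x _ hU] with y ⟨t, ht0, ht1, htU⟩
    have hadd := cocycle_add_of_isZero_homology S h c hc (a := s x) (b := t) (e := s y)
      (toSimplexMap_zero_injective ι hι (by rw [h1, h1, hs0, hs0]))
      (toSimplexMap_zero_injective ι hι (by rw [h0, h1, hs1, ht0]))
      (toSimplexMap_zero_injective ι hι (by rw [h0, h0, ht1, hs1]))
    have hlt : |c t| < min ε (1 / 2) := abs_increment_lt (lt_min hε (by norm_num))
      (min_le_right _ _) (fun z => by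
        simp only [ContinuousMap.comp_apply]
        rw [ht0]
        exact htU z)
    rw [Real.dist_eq, hadd]
    rw [show r₀ + (c (s x) + c t) - (r₀ + c (s x)) = c t by ring]
    exact hlt.trans_le (min_le_left _ _)
  · simp only [ContinuousMap.coe_mk]
    rw [AddCircle.coe_add, hcoe, hs0, hs1]
    rw [hr₀]
    abel

end Lifting

section QuasiConvex

variable {X : Type u} [MetricSpace X]

/-- A curve of finite length has a Lipschitz reparametrization. -/
theorem exists_lipschitz_reparametrization {x y : X} (γ : Path x y)
    (h : eVariationOn γ univ ≠ ∞) :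
    ∃ (K : ℝ≥0) (g : unitInterval → X), LipschitzWith K g ∧ g 0 = x ∧ g 1 = y ∧
      range g ⊆ range γ := by
  have hbv : LocallyBoundedVariationOn γ univ :=
    BoundedVariationOn.locallyBoundedVariationOn h
  set w : unitInterval → ℝ := variationOnFromTo γ univ 0 with hw
  have hmono : Monotone w := fun s t hst =>
    variationOnFromTo.monotoneOn hbv (mem_univ 0) (mem_univ s) (mem_univ t) hst
  have hdist' : ∀ s t, s ≤ t → dist (γ s) (γ t) ≤ w t - w s := by
    intro s t hst
    have h1 : w t - w s = variationOnFromTo γ univ s t := by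
      have := variationOnFromTo.add hbv (mem_univ 0) (mem_univ s) (mem_univ t)
      simp only [hw]; linarith
    rw [h1, variationOnFromTo.eq_of_le _ _ hst, dist_edist]
    refine ENNReal.toReal_mono (hbv s t trivial trivial) ?_
    exact eVariationOn.edist_le γ ⟨trivial, le_refl s, hst⟩ ⟨trivial, hst, le_refl t⟩
  have hdist : ∀ s t, dist (γ s) (γ t) ≤ |w s - w t| := by
    intro s t
    rcases le_total s t with hst | hst
    · rw [abs_sub_comm]
      exact (hdist' s t hst).trans (le_abs_self _)
    · rw [dist_comm]
      exact (hdist' t s hst).trans (le_abs_self _)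
  have hcont : Continuous w := by
    rw [continuous_iff_continuousAt]
    intro b
    have hγ : Filter.Tendsto γ (𝓝 b) (𝓝 (γ b)) := γ.continuous.tendsto b
    have hl := variationOnFromTo.tendsto_left (mem_univ 0) (mem_univ b) hbv
      (hγ.mono_left (nhdsWithin_le_nhds (s := univ ∩ Iio b)))
    have hr := variationOnFromTo.tendsto_right (mem_univ 0) (mem_univ b) hbv
      (hγ.mono_left (nhdsWithin_le_nhds (s := univ ∩ Ioi b)))
    rw [dist_self, sub_zero, univ_inter] at hl
    rw [dist_self, add_zero, univ_inter] at hr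
    exact continuousAt_iff_continuous_left'_right'.2 ⟨hl, hr⟩
  have hw0 : w 0 = 0 := variationOnFromTo.self _ _ _
  have hw1 : 0 ≤ w 1 := hw0 ▸ hmono (zero_le_one)
  have hex : ∀ r : unitInterval, ∃ t, w t = r * w 1 := by
    intro r
    have := intermediate_value_univ (0 : unitInterval) 1 hcont
    rw [hw0] at this
    exact this ⟨mul_nonneg r.2.1 hw1, mul_le_of_le_one_left hw1 r.2.2⟩
  choose t ht using hex
  refine ⟨(w 1).toNNReal, fun r => γ (t r), LipschitzWith.of_dist_le_mul fun r s => ?_, ?_, ?_, ?_⟩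
  · refine (hdist _ _).trans (le_of_eq ?_)
    rw [ht, ht, ← sub_mul, abs_mul, abs_of_nonneg hw1, Real.coe_toNNReal _ hw1, mul_comm]
    rfl
  · have := hdist (t 0) 0
    rw [ht, hw0] at this
    simpa using this
  · have := hdist (t 1) 1
    rw [ht] at this
    simpa using this
  · rintro _ ⟨r, rfl⟩
    exact ⟨_, rfl⟩

variable {C : ℝ}

/-- In a quasi-convex space, nearby points are joined by short curves. -/
theorem IsQuasiConvex.eventually_exists_path (hX : IsQuasiConvex C X) (x : X) {U : Set X}
    (hU : U ∈ 𝓝 x) :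
    ∀ᶠ y in 𝓝 x, ∃ γ : Path x y, eVariationOn γ univ ≠ ∞ ∧ range γ ⊆ U := by
  obtain ⟨ε, hε, hball⟩ := Metric.mem_nhds_iff.1 hU
  have hlim : Filter.Tendsto (fun y => C * dist x y) (𝓝 x) (𝓝 0) := by
    have : Continuous (fun y => C * dist x y) := by fun_prop
    simpa using this.tendsto x
  filter_upwards [hlim.eventually (gt_mem_nhds hε)] with y hy
  obtain ⟨γ, hγ⟩ := hX x y
  refine ⟨γ, ne_top_of_le_ne_top ENNReal.ofReal_ne_top hγ, ?_⟩
  rintro _ ⟨t, rfl⟩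
  apply hball
  have h1 : edist (γ t) (γ 0) ≤ ENNReal.ofReal (C * dist x y) :=
    (eVariationOn.edist_le γ (mem_univ t) (mem_univ 0)).trans hγ
  rw [γ.source] at h1
  rw [Metric.mem_ball, ← ENNReal.ofReal_lt_ofReal_iff hε, ← edist_dist]
  exact h1.trans_lt ((ENNReal.ofReal_lt_ofReal_iff hε).2 hy)

theorem IsQuasiConvex.locallyPathConnectedSpace (hX : IsQuasiConvex C X) :
    LocallyPathConnectedSpace X := by
  rw [locallyPathConnectedSpace_iff_pathComponentIn_mem_nhds]
  intro x U hU hxU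
  filter_upwards [hX.eventually_exists_path x (hU.mem_nhds hxU)] with y ⟨γ, _, hγ⟩
  exact ⟨γ, fun t => hγ ⟨t, rfl⟩⟩

theorem dist_stdSimplexHomeomorphUnitInterval_le (z w : stdSimplex ℝ (Fin 2)) :
    dist (stdSimplexHomeomorphUnitInterval z) (stdSimplexHomeomorphUnitInterval w) ≤ dist z w := by
  rw [Subtype.dist_eq, Subtype.dist_eq]
  exact dist_le_pi_dist z.1 w.1 1

/-- On a quasi-convex space with vanishing first (Lipschitz) homology, circle valued maps lift to
the real line. -/
theorem IsQuasiConvex.exists_lift (hX : IsQuasiConvex C X)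
    (hH : SingularH1Vanishes X ∨ LipschitzH1Vanishes X) (f : C(X, AddCircle (1 : ℝ))) :
    ∃ F : C(X, ℝ), ∀ x, (F x : AddCircle (1 : ℝ)) = f x := by
  rcases isEmpty_or_nonempty X with hemp | hne
  · exact ⟨⟨fun x => hemp.elim x, continuous_of_const fun x => hemp.elim x⟩,
      fun x => hemp.elim x⟩
  rcases hH with hH | hH
  · let S := TopCat.toSSet.obj (TopCat.of X)
    have hsimp : ∀ {U : Set X} {x y : X} (γ : Path x y), range γ ⊆ U →
        JoinedBySimplex (𝟙 S) U x y := by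
      intro U x y γ hγ
      let s : C(stdSimplex ℝ (Fin 2), X) :=
        γ.toContinuousMap.comp ⟨_, stdSimplexHomeomorphUnitInterval.continuous⟩
      have hs : toSimplexMap (𝟙 S) (n := 1) (((TopCat.of X).toSSetObjEquiv _).symm s) = s :=
        Equiv.apply_symm_apply _ _
      refine ⟨((TopCat.of X).toSSetObjEquiv _).symm s, ?_, ?_, fun z => ?_⟩
      · rw [hs]; exact γ.source
      · rw [hs]; exact γ.target
      · rw [hs]; exact hγ ⟨_, rfl⟩
    refine exists_lift_of_isZero_homology (𝟙 S) (fun _ _ h => h) hH ?_ ?_ f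
    · exact fun x y => hsimp (hX x y).choose (subset_univ _)
    · intro x U hU
      filter_upwards [hX.eventually_exists_path x hU] with y ⟨γ, _, hγ⟩
      exact hsimp γ hγ
  · let S := lipschitzSingularSet X
    have hsimp : ∀ {U : Set X} {x y : X} (γ : Path x y), eVariationOn γ univ ≠ ∞ →
        range γ ⊆ U → JoinedBySimplex S.ι U x y := by
      intro U x y γ hfin hγ
      obtain ⟨K, g, hg, hg0, hg1, hgr⟩ := exists_lipschitz_reparametrization γ hfin
      let s : C(stdSimplex ℝ (Fin 2), X) :=
        (⟨g, hg.continuous⟩ : C(unitInterval, X)).comp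
          ⟨_, stdSimplexHomeomorphUnitInterval.continuous⟩
      let t := ((TopCat.of X).toSSetObjEquiv (.op (.mk 1))).symm s
      have ht : t ∈ S.obj (.op (.mk 1)) := ⟨K, LipschitzWith.of_dist_le_mul fun z w =>
        (hg.dist_le_mul _ _).trans (mul_le_mul_of_nonneg_left
          (dist_stdSimplexHomeomorphUnitInterval_le z w) K.2)⟩
      have hs : toSimplexMap S.ι (n := 1) ⟨t, ht⟩ = s := Equiv.apply_symm_apply _ _
      refine ⟨⟨t, ht⟩, ?_, ?_, fun z => ?_⟩
      · rw [hs]; exact hg0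
      · rw [hs]; exact hg1
      · rw [hs]; exact hγ (hgr ⟨_, rfl⟩)
    refine exists_lift_of_isZero_homology S.ι Subtype.val_injective hH ?_ ?_ f
    · intro x y
      obtain ⟨γ, hγ⟩ := hX x y
      exact hsimp γ (ne_top_of_le_ne_top ENNReal.ofReal_ne_top hγ) (subset_univ _)
    · intro x U hU
      filter_upwards [hX.eventually_exists_path x hU] with y ⟨γ, hfin, hγ⟩
      exact hsimp γ hfin hγ

end QuasiConvex

section Separation

variable {X : Type u}

theorem mem_pathComponentIn_of_mem_closure [TopologicalSpace X] [LocallyPathConnectedSpace X]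
    {O : Set X} (hO : IsOpen O) {x y : X}
    (hy : y ∈ closure (pathComponentIn O x)) (hyO : y ∈ O) : y ∈ pathComponentIn O x := by
  obtain ⟨z, hz, hz'⟩ := mem_closure_iff.1 hy _ (hO.pathComponentIn y)
    (mem_pathComponentIn_self hyO)
  exact JoinedIn.trans hz' (JoinedIn.symm hz)

theorem joinedIn_of_isPreconnected [TopologicalSpace X] [LocallyPathConnectedSpace X]
    {A U : Set X} (hA : IsPreconnected A) (hU : IsOpen U) (hAU : A ⊆ U) {x y : X} (hx : x ∈ A)
    (hy : y ∈ A) : JoinedIn U x y := by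
  have h := hA.subset_left_of_subset_union (u := pathComponentIn U x)
    (v := U \ pathComponentIn U x) (hU.pathComponentIn x) ?_ disjoint_sdiff_right ?_
    ⟨x, hx, mem_pathComponentIn_self (hAU hx)⟩
  · exact h hy
  · rw [isOpen_iff_mem_nhds]
    rintro z ⟨hzU, hz⟩
    filter_upwards [(hU.pathComponentIn z).mem_nhds (mem_pathComponentIn_self hzU)] with w hw
    exact ⟨JoinedIn.target_mem hw, fun h => hz (JoinedIn.trans h (JoinedIn.symm hw))⟩
  · intro z hz
    by_cases h : z ∈ pathComponentIn U x
    · exact Or.inl h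
    · exact Or.inr ⟨hAU hz, h⟩

/-- The complement of a component of the complement of a closed connected set is connected. -/
theorem isPreconnected_compl_pathComponentIn [TopologicalSpace X] [LocallyPathConnectedSpace X]
    [PreconnectedSpace X] {K : Set X} (hK : IsClosed K) (hKc : IsConnected K) (b : X) :
    IsPreconnected (pathComponentIn Kᶜ b)ᶜ := by
  obtain ⟨a, ha⟩ := hKc.nonempty
  have hO := hK.isOpen_compl
  have hsub : K ⊆ (pathComponentIn Kᶜ b)ᶜ := fun z hz hz' => JoinedIn.target_mem hz' hz
  refine isPreconnected_of_forall a fun w hw => ?_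
  by_cases hwK : w ∈ K
  · exact ⟨K, hsub, ha, hwK, hKc.isPreconnected⟩
  have hww : w ∈ pathComponentIn Kᶜ w := mem_pathComponentIn_self hwK
  have hcl : (K ∩ closure (pathComponentIn Kᶜ w)).Nonempty := by
    by_contra hemp
    have hclo : IsClosed (pathComponentIn Kᶜ w) := by
      refine isClosed_of_closure_subset fun z hz => ?_
      exact mem_pathComponentIn_of_mem_closure hO hz fun hzK => hemp ⟨z, hzK, hz⟩
    have huniv := IsClopen.eq_univ ⟨hclo, hO.pathComponentIn w⟩ ⟨w, hww⟩
    have : a ∈ pathComponentIn Kᶜ w := by rw [huniv]; trivial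
    exact JoinedIn.target_mem this ha
  refine ⟨K ∪ closure (pathComponentIn Kᶜ w), union_subset hsub ?_, Or.inl ha,
    Or.inr (subset_closure hww), ?_⟩
  · intro z hz hzb
    obtain ⟨y, hyb, hyw⟩ := mem_closure_iff.1 hz _ (hO.pathComponentIn b) hzb
    exact hw (JoinedIn.trans hyb (JoinedIn.symm hyw))
  · exact IsPreconnected.union' hcl hKc.isPreconnected
      (isPathConnected_pathComponentIn hwK).isConnected.isPreconnected.closure

theorem eq_of_isPreconnected_of_coe_eq_zero [TopologicalSpace X] {A : Set X}
    (hA : IsPreconnected A) {F : X → ℝ} (hF : Continuous F)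
    (h : ∀ z ∈ A, (F z : AddCircle (1 : ℝ)) = 0) {x y : X} (hx : x ∈ A) (hy : y ∈ A) :
    F x = F y := by
  have := (AddCircle.isCoveringMap_coe (1 : ℝ)).eqOn_of_comp_eqOn hA hF.continuousOn
    (continuousOn_const (c := F x)) (fun z hz => by simp [h z hz, h x hx]) hx rfl
  exact (this hy).symm

/-- If circle valued maps lift to the real line, the boundary of an open connected set with
connected complement is connected. -/
theorem isPreconnected_frontier_of_exists_lift [MetricSpace X]
    (hlift : ∀ f : C(X, AddCircle (1 : ℝ)), ∃ F : C(X, ℝ), ∀ x, (F x : AddCircle (1 : ℝ)) = f x)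
    {V : Set X} (hV : IsOpen V) (hVc : IsPreconnected V) (hVc' : IsPreconnected Vᶜ) :
    IsPreconnected (frontier V) := by
  classical
  rw [isPreconnected_closed_iff]
  intro A B hA hB hAB hKA hKB
  by_contra hemp
  have hdisj : Disjoint (frontier V ∩ A) (frontier V ∩ B) := by
    rw [disjoint_left]
    rintro z ⟨hz, hzA⟩ ⟨_, hzB⟩
    exact hemp ⟨z, hz, hzA, hzB⟩
  obtain ⟨u, hu0, hu1, -⟩ := exists_continuous_zero_one_of_isClosed
    (isClosed_frontier.inter hA) (isClosed_frontier.inter hB) hdisj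
  have hfr : frontier V = closure V \ V := hV.frontier_eq
  let f : C(X, AddCircle (1 : ℝ)) := ⟨fun z => if z ∈ V then (u z : AddCircle (1 : ℝ)) else 0, by
    refine continuous_if (fun z hz => ?_) ?_ continuousOn_const
    · rcases hAB hz with h | h
      · have : u z = 0 := hu0 ⟨hz, h⟩
        simp [this]
      · have : u z = 1 := hu1 ⟨hz, h⟩
        simp [this]
    · exact ((AddCircle.continuous_mk' 1).comp u.continuous).continuousOn⟩
  obtain ⟨F, hF⟩ := hlift f
  obtain ⟨p, hpK, hpA⟩ := hKA
  obtain ⟨q, hqK, hqB⟩ := hKB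
  have hup : u p = 0 := hu0 ⟨hpK, hpA⟩
  have huq : u q = 1 := hu1 ⟨hqK, hqB⟩
  have hpq := hpK
  have hqq := hqK
  rw [hfr] at hpq hqq
  have h1 : F p = F q := eq_of_isPreconnected_of_coe_eq_zero hVc' F.continuous
    (fun z hz => by rw [hF]; exact if_neg hz) hpq.2 hqq.2
  have h2 : F p - u p = F q - u q := by
    refine eq_of_isPreconnected_of_coe_eq_zero hVc.closure (F := fun z => F z - u z)
      (by fun_prop) (fun z hz => ?_) hpq.1 hqq.1
    rw [AddCircle.coe_sub, hF, sub_eq_zero]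
    by_cases hzV : z ∈ V
    · exact if_pos hzV
    · have hzK : z ∈ frontier V := by rw [hfr]; exact ⟨hz, hzV⟩
      refine (if_neg hzV).trans ?_
      rcases hAB hzK with h | h
      · have : u z = 0 := hu0 ⟨hzK, h⟩
        simp [this]
      · have : u z = 1 := hu1 ⟨hzK, h⟩
        rw [this]
        exact (AddCircle.coe_period (1 : ℝ)).symm
  rw [h1, hup, huq] at h2
  linarith

/-- If circle valued maps lift to the real line, a closed set separating two points contains a
connected set separating them. -/
theorem exists_isConnected_separator [MetricSpace X] [LocallyPathConnectedSpace X]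
    [PathConnectedSpace X]
    (hlift : ∀ f : C(X, AddCircle (1 : ℝ)), ∃ F : C(X, ℝ), ∀ x, (F x : AddCircle (1 : ℝ)) = f x)
    {F : Set X} (hF : IsClosed F) {a b : X} (hab : ¬ JoinedIn Fᶜ a b) :
    ∃ K ⊆ F, IsConnected K ∧ ¬ JoinedIn Kᶜ a b := by
  by_cases haF : a ∈ F
  · exact ⟨{a}, by simpa using haF, isConnected_singleton, fun h => h.source_mem rfl⟩
  by_cases hbF : b ∈ F
  · exact ⟨{b}, by simpa using hbF, isConnected_singleton, fun h => h.target_mem rfl⟩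
  set U := pathComponentIn Fᶜ a with hUdef
  have hFo := hF.isOpen_compl
  have hUo : IsOpen U := hFo.pathComponentIn a
  have haU : a ∈ U := mem_pathComponentIn_self haF
  have hbU : b ∉ closure U := fun h => hab (mem_pathComponentIn_of_mem_closure hFo h hbF)
  have hUc : IsConnected U := (isPathConnected_pathComponentIn haF).isConnected
  set V := pathComponentIn (closure U)ᶜ b with hVdef
  have hVo : IsOpen V := isClosed_closure.isOpen_compl.pathComponentIn b
  have hbV : b ∈ V := mem_pathComponentIn_self hbU
  have hVU : ∀ z ∈ V, z ∉ closure U := fun z hz => JoinedIn.target_mem hz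
  have hfr : frontier V = closure V \ V := hVo.frontier_eq
  have hUV : ∀ z ∈ U, z ∉ closure V := by
    intro z hz hzV
    obtain ⟨y, hyU, hyV⟩ := mem_closure_iff.1 hzV U hUo hz
    exact hVU y hyV (subset_closure hyU)
  have hcross : ¬ JoinedIn (frontier V)ᶜ a b := by
    rintro ⟨γ, hγ⟩
    have hsub := (isPreconnected_range γ.continuous).subset_left_of_subset_union
      (u := V) (v := (closure V)ᶜ) hVo isClosed_closure.isOpen_compl
      (disjoint_left.2 fun z hz hz' => hz' (subset_closure hz)) (by
        rintro _ ⟨t, rfl⟩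
        by_contra hcon
        rw [mem_union, not_or] at hcon
        exact hγ t (by rw [hfr]; exact ⟨not_not.1 hcon.2, hcon.1⟩)) ⟨b, mem_range.2 ⟨1, γ.target⟩, hbV⟩
    exact hUV a haU (subset_closure (hsub (mem_range.2 ⟨0, γ.source⟩)))
  refine ⟨frontier V, ?_, ⟨?_, ?_⟩, hcross⟩
  · intro w hw
    rw [hfr] at hw
    have hwcl : w ∈ closure U := by
      by_contra h
      exact hw.2 (mem_pathComponentIn_of_mem_closure isClosed_closure.isOpen_compl hw.1 h)
    by_contra hwF
    exact hUV w (mem_pathComponentIn_of_mem_closure hFo hwcl hwF) hw.1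
  · by_contra hemp
    rw [not_nonempty_iff_eq_empty] at hemp
    rw [hemp, compl_empty, joinedIn_univ] at hcross
    exact hcross (PathConnectedSpace.joined a b)
  · exact isPreconnected_frontier_of_exists_lift hlift hVo
      (isPathConnected_pathComponentIn hbU).isConnected.isPreconnected
      (isPreconnected_compl_pathComponentIn isClosed_closure hUc.closure b)

end Separation

section Separates

variable {T : Type u} [TopologicalSpace T] {a b p q r s : T}

/-- Every path from `a` to `b` passes through `q`. -/
def Separates (q a b : T) : Prop := ¬ JoinedIn {q}ᶜ a b

theorem Separates.symm (h : Separates q a b) : Separates q b a := fun h' => h h'.symm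

theorem separates_left (a b : T) : Separates a a b := fun h => h.source_mem rfl

theorem separates_right (a b : T) : Separates b a b := fun h => h.target_mem rfl

theorem Separates.left_or_right (h : Separates q a b) (c : T) :
    Separates q a c ∨ Separates q c b := by
  by_contra hcon
  rw [not_or] at hcon
  exact h ((not_not.1 hcon.1).trans (not_not.1 hcon.2))

theorem Separates.mem_of_joinedIn {F : Set T} (h : Separates q a b) (hF : JoinedIn F a b) :
    q ∈ F := by
  by_contra hq
  exact h (hF.mono fun z hz hzq => hq (hzq ▸ hz))

theorem Separates.mem_range (h : Separates q a b) (γ : Path a b) : q ∈ range γ :=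
  h.mem_of_joinedIn ⟨γ, fun t => ⟨t, rfl⟩⟩

theorem joinedIn_image_Icc (γ : Path a b) {s t : unitInterval} (hst : s ≤ t) :
    JoinedIn (γ '' Icc s t) (γ s) (γ t) := by
  have h : IsPathConnected (γ.extend '' Icc (s : ℝ) t) :=
    ((convex_Icc (s : ℝ) t).isPathConnected ⟨s, left_mem_Icc.2 hst⟩).image γ.continuous_extend
  have hsub : γ.extend '' Icc (s : ℝ) t ⊆ γ '' Icc s t := by
    rintro _ ⟨r, hr, rfl⟩
    have hrI : r ∈ unitInterval := ⟨s.2.1.trans hr.1, hr.2.trans t.2.2⟩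
    exact ⟨⟨r, hrI⟩, ⟨hr.1, hr.2⟩, (γ.extend_apply hrI).symm⟩
  refine (h.joinedIn _ ?_ _ ?_).mono hsub
  · exact ⟨s, left_mem_Icc.2 hst, γ.extend_apply s.2⟩
  · exact ⟨t, right_mem_Icc.2 hst, γ.extend_apply t.2⟩

theorem Separates.joinedIn_of_joinedIn {F : Set T} (hp : Separates p a b) (hq : Separates q a b)
    (hF : JoinedIn F a b) : JoinedIn F p q := by
  obtain ⟨γ, hγ⟩ := hF
  obtain ⟨s, rfl⟩ := hp.mem_range γ
  obtain ⟨t, rfl⟩ := hq.mem_range γ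
  have hsub : ∀ s t, γ '' Icc s t ⊆ F := fun s t => image_subset_iff.2 fun r _ => hγ r
  rcases le_total s t with h | h
  · exact (joinedIn_image_Icc γ h).mono (hsub _ _)
  · exact ((joinedIn_image_Icc γ h).mono (hsub _ _)).symm

theorem Separates.trans (hp : Separates p a b) (hq : Separates q a b) (hr : Separates r p q) :
    Separates r a b := fun h => hr (hp.joinedIn_of_joinedIn hq h)

theorem isClosed_setOf_separates [T2Space T] (a b : T) : IsClosed {q | Separates q a b} := by
  rw [← isOpen_compl_iff, isOpen_iff_mem_nhds]
  intro q hq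
  obtain ⟨γ, hγ⟩ := not_not.1 hq
  have hopen : IsOpen (range γ)ᶜ := (isCompact_range γ.continuous).isClosed.isOpen_compl
  filter_upwards [hopen.mem_nhds (fun ⟨t, ht⟩ => hγ t ht)] with z hz
  exact not_not.2 ⟨γ, fun t ht => hz ⟨t, ht⟩⟩

theorem Separates.exists_mem_Ioo (γ : Path a b) {s t : unitInterval} (hst : s ≤ t)
    (hs : Separates (γ s) a b) (ht : Separates (γ t) a b) (hr : Separates r (γ s) (γ t))
    (hrs : r ≠ γ s) (hrt : r ≠ γ t) : Separates r a b ∧ ∃ u ∈ Ioo s t, γ u = r := by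
  refine ⟨hs.trans ht hr, ?_⟩
  obtain ⟨u, hu, rfl⟩ := hr.mem_of_joinedIn (joinedIn_image_Icc γ hst)
  refine ⟨u, ⟨lt_of_le_of_ne hu.1 ?_, lt_of_le_of_ne hu.2 ?_⟩, rfl⟩
  · rintro rfl; exact hrs rfl
  · rintro rfl; exact hrt rfl

theorem not_separates_or_not_separates [PathConnectedSpace T] [T1Space T] (a : T) (h : p ≠ q) :
    ¬ Separates q a p ∨ ¬ Separates p a q := by
  obtain ⟨γ⟩ := PathConnectedSpace.joined a p
  have hcl : IsClosed (γ ⁻¹' {p, q}) := ((finite_singleton q).insert p).isClosed.preimage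
    γ.continuous
  obtain ⟨t, ht, hmin⟩ := hcl.isCompact.exists_isLeast ⟨1, Or.inl γ.target⟩
  have hJ := joinedIn_image_Icc γ (unitInterval.nonneg' : (0 : unitInterval) ≤ t)
  rw [γ.source] at hJ
  rcases ht with ht | ht
  · left
    rw [ht] at hJ
    refine not_not.2 (hJ.mono ?_)
    rintro _ ⟨s, hs, rfl⟩ hsq
    have hts : t ≤ s := hmin (Or.inr hsq)
    rw [le_antisymm hs.2 hts] at hsq
    exact h (ht.symm.trans hsq)
  · right
    rw [show γ t = q from ht] at hJ
    refine not_not.2 (hJ.mono ?_)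
    rintro _ ⟨s, hs, rfl⟩ hsq
    have hts : t ≤ s := hmin (Or.inl hsq)
    rw [le_antisymm hs.2 hts] at hsq
    exact h (hsq.symm.trans ht)

theorem Separates.antisymm [PathConnectedSpace T] [T1Space T] (h : Separates p a q)
    (h' : Separates q a p) : p = q := by
  by_contra hne
  rcases not_separates_or_not_separates a hne with h1 | h1
  · exact h1 h'
  · exact h1 h

theorem Separates.total [PathConnectedSpace T] [T1Space T] (hp : Separates p a b)
    (hq : Separates q a b) : Separates p a q ∨ Separates q a p := by
  rcases hp.left_or_right q with h | h
  · exact Or.inl h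
  rcases hq.left_or_right p with h' | h'
  · exact Or.inr h'
  obtain rfl := Separates.antisymm h.symm h'.symm
  exact Or.inl (separates_right _ _)

theorem Separates.not_separates_of_between [PathConnectedSpace T] [T1Space T]
    (h : Separates p a q) (hr : Separates r p q) (hrp : r ≠ p) : ¬ Separates r a p := by
  intro h'
  have h1 : ¬ Separates p a r := fun h'' => hrp (Separates.antisymm h' h'')
  have h2 : ¬ Separates p q r := fun h'' => hrp (Separates.antisymm hr.symm h'')
  rcases h.left_or_right r with h3 | h3
  · exact h1 h3
  · exact h2 h3.symm

end Separates

section Metric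

open scoped Classical in
/-- The distance to `a`, cut off to `0` before `a` on the way from `p`. -/
noncomputable def cutDist {T : Type u} [MetricSpace T] (p a q : T) : ℝ :=
  if Separates a p q then dist a q else 0

variable {T : Type u} [MetricSpace T]

theorem dist_le_of_separates
    (hA : ∀ (p q : T) (r : ℝ), dist p q < r → JoinedIn (Metric.ball p r) p q) {a b q : T}
    (h : Separates b a q) : dist a b ≤ dist a q := by
  refine le_of_forall_gt fun r hr => ?_
  rw [dist_comm]
  exact h.mem_of_joinedIn (hA a q r hr)

theorem cutDist_nonneg (p a q : T) : 0 ≤ cutDist p a q := by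
  unfold cutDist
  split_ifs
  exacts [dist_nonneg, le_rfl]

theorem continuous_cutDist
    (hA : ∀ (p q : T) (r : ℝ), dist p q < r → JoinedIn (Metric.ball p r) p q) (p a : T) :
    Continuous (cutDist p a) := by
  refine LipschitzWith.continuous (K := 1) (LipschitzWith.of_le_add_mul 1 fun x y => ?_)
  rw [NNReal.coe_one, one_mul]
  unfold cutDist
  split_ifs with hx hy hy
  · rw [dist_comm x y, add_comm, dist_comm y x, add_comm, dist_comm x y]
    exact dist_triangle a y x
  · rw [zero_add, dist_comm a x]
    rcases hx.left_or_right y with h | h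
    · exact (hy h).elim
    · exact dist_le_of_separates hA h.symm
  · positivity
  · positivity

theorem cutDist_mono [PathConnectedSpace T]
    (hA : ∀ (p q : T) (r : ℝ), dist p q < r → JoinedIn (Metric.ball p r) p q) (p a : T) {q q' : T}
    (h : Separates q p q') : cutDist p a q ≤ cutDist p a q' := by
  by_cases ha : Separates a p q
  · have ha' : Separates a p q' := (separates_left p q').trans h ha
    unfold cutDist
    rw [if_pos ha, if_pos ha']
    rcases h.left_or_right a with h1 | h1
    · rw [ha.antisymm h1, dist_self]
      exact dist_nonneg
    · exact dist_le_of_separates hA h1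
  · unfold cutDist
    rw [if_neg ha]
    exact cutDist_nonneg p a q'

theorem exists_strictMono_on_separators [PathConnectedSpace T]
    (hA : ∀ (p q : T) (r : ℝ), dist p q < r → JoinedIn (Metric.ball p r) p q)
    (hB : ∀ p q : T, p ≠ q → ∃ r, r ≠ p ∧ r ≠ q ∧ Separates r p q)
    (p₀ p₁ : T) :
    ∃ G : T → ℝ, Continuous G ∧ ∀ q q', Separates q' p₀ p₁ → Separates q p₀ q' → q ≠ q' →
      G q < G q' := by
  set E : Set T := {q | Separates q p₀ p₁}
  obtain ⟨γ⟩ := PathConnectedSpace.joined p₀ p₁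
  have hEc : IsCompact E := (isCompact_range γ.continuous).of_isClosed_subset
    (isClosed_setOf_separates _ _) fun q hq => hq.mem_range γ
  have : CompactSpace E := isCompact_iff_compactSpace.1 hEc
  have : Nonempty E := ⟨⟨p₀, separates_left _ _⟩⟩
  let d : ℕ → E := TopologicalSpace.denseSeq E
  have hd : DenseRange d := TopologicalSpace.denseRange_denseSeq E
  let F : ℕ → T → ℝ := fun n q => (1 / 2 : ℝ) ^ n * min 1 (cutDist p₀ (d n) q)
  have hF0 : ∀ n q, 0 ≤ F n q := fun n q =>
    mul_nonneg (by positivity) (le_min zero_le_one (cutDist_nonneg _ _ _))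
  have hF1 : ∀ n q, F n q ≤ (1 / 2 : ℝ) ^ n := fun n q =>
    mul_le_of_le_one_right (by positivity) (min_le_left _ _)
  have hsum : ∀ q, Summable fun n => F n q := fun q =>
    Summable.of_nonneg_of_le (fun n => hF0 n q) (fun n => hF1 n q) summable_geometric_two
  refine ⟨fun q => ∑' n, F n q, ?_, fun q q' hq' hqq' hne => ?_⟩
  · refine continuous_tsum (fun n => ?_) summable_geometric_two fun n q => ?_
    · exact continuous_const.mul (continuous_const.min (continuous_cutDist hA _ _))
    · rw [Real.norm_of_nonneg (hF0 n q)]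
      exact hF1 n q
  · obtain ⟨r, hrq, hrq', hr⟩ := hB q q' hne
    have hrp : Separates r p₀ q' := hqq'.trans (separates_right _ _) hr
    have h1 : ¬ Separates r p₀ q := hqq'.not_separates_of_between hr hrq
    have h2 : ¬ Separates r q' p₁ := by
      intro h
      have h3 : ¬ Separates q' p₀ r := fun h' => hrq' (hrp.antisymm h')
      rcases hq'.left_or_right r with h4 | h4
      · exact h3 h4
      · exact hrq' (Separates.antisymm h.symm h4.symm)
    have hrE : Separates r p₀ p₁ := (separates_left _ _).trans hq' hrp
    have hopen : IsOpen {a : E | ¬ Separates a.1 p₀ q ∧ ¬ Separates a.1 q' p₁} :=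
      ((isClosed_setOf_separates p₀ q).isOpen_compl.inter
        (isClosed_setOf_separates q' p₁).isOpen_compl).preimage continuous_subtype_val
    obtain ⟨n, hn1, hn2⟩ := hd.exists_mem_open hopen ⟨⟨r, hrE⟩, h1, h2⟩
    have hn3 : Separates (d n).1 p₀ q' := by
      rcases (d n).2.left_or_right q' with h | h
      · exact h
      · exact (hn2 h).elim
    have hn4 : (d n).1 ≠ q' := fun h => hn2 (h ▸ separates_left q' p₁)
    refine Summable.tsum_lt_tsum (i := n) (fun m => ?_) ?_ (hsum q) (hsum q')
    · exact mul_le_mul_of_nonneg_left (min_le_min le_rfl (cutDist_mono hA _ _ hqq'))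
        (by positivity)
    · refine mul_lt_mul_of_pos_left ?_ (by positivity)
      have e1 : cutDist p₀ (d n).1 q = 0 := if_neg hn1
      have e2 : cutDist p₀ (d n).1 q' = dist (d n).1 q' := if_pos hn3
      rw [e1, e2, min_eq_right zero_le_one]
      exact lt_min zero_lt_one (dist_pos.2 hn4)

theorem range_eq_of_injective
    (hB : ∀ p q : T, p ≠ q → ∃ r, r ≠ p ∧ r ≠ q ∧ Separates r p q)
    (γ : C(unitInterval, T)) (hγ : Function.Injective γ) :
    range γ = {q | Separates q (γ 0) (γ 1)} := by
  let γ' : Path (γ 0) (γ 1) := ⟨γ, rfl, rfl⟩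
  refine Subset.antisymm ?_ fun q hq => hq.mem_range γ'
  rintro _ ⟨t, rfl⟩
  by_contra ht
  have hS : IsClosed (γ ⁻¹' {q | Separates q (γ 0) (γ 1)}) :=
    (isClosed_setOf_separates _ _).preimage γ.continuous
  obtain ⟨s, ⟨hsS, hst⟩, hsmax⟩ := (hS.inter isClosed_Iic).isCompact.exists_isGreatest
    ⟨0, separates_left _ _, (unitInterval.nonneg' : (0 : unitInterval) ≤ t)⟩
  obtain ⟨w, ⟨hwS, htw⟩, hwmin⟩ := (hS.inter isClosed_Ici).isCompact.exists_isLeast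
    ⟨1, separates_right _ _, (unitInterval.le_one' : t ≤ 1)⟩
  have hst' : s < t := lt_of_le_of_ne hst fun h => ht (h ▸ hsS)
  have htw' : t < w := lt_of_le_of_ne htw fun h => ht (h ▸ hwS)
  obtain ⟨r, hrs, hrw, hr⟩ := hB (γ s) (γ w) fun h => (hst'.trans htw').ne (hγ h)
  obtain ⟨hrS, u, hu, rfl⟩ := Separates.exists_mem_Ioo γ' (hst'.trans htw').le hsS hwS hr hrs hrw
  rcases le_total u t with h | h
  · exact absurd (hsmax ⟨hrS, h⟩) (not_le.2 hu.1)
  · exact absurd (hwmin ⟨hrS, h⟩) (not_le.2 hu.2)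

/-- A metric space in which balls are path-connected around their centers, and in which any two
points are separated by a third one, is a tree. -/
theorem isTree_of_separates
    (hA : ∀ (p q : T) (r : ℝ), dist p q < r → JoinedIn (Metric.ball p r) p q)
    (hB : ∀ p q : T, p ≠ q → ∃ r, r ≠ p ∧ r ≠ q ∧ Separates r p q) :
    IsTree T := by
  have hpc : ∀ p q : T, JoinedIn univ p q := fun p q =>
    (hA p q (dist p q + 1) (by linarith)).mono (subset_univ _)
  constructor
  · intro p₀ p₁ hne
    have : PathConnectedSpace T := ⟨⟨p₀⟩, fun p q => joinedIn_univ.1 (hpc p q)⟩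
    obtain ⟨G, hG, hmono⟩ := exists_strictMono_on_separators hA hB p₀ p₁
    set E : Set T := {q | Separates q p₀ p₁}
    have h0E : p₀ ∈ E := separates_left _ _
    have h1E : p₁ ∈ E := separates_right _ _
    obtain ⟨γ⟩ := PathConnectedSpace.joined p₀ p₁
    have hEc : IsCompact E := (isCompact_range γ.continuous).of_isClosed_subset
      (isClosed_setOf_separates _ _) fun q hq => hq.mem_range γ
    have : CompactSpace E := isCompact_iff_compactSpace.1 hEc
    have hle : ∀ q q', q' ∈ E → Separates q p₀ q' → G q ≤ G q' := by
      intro q q' hq' h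
      by_cases hqq : q = q'
      · rw [hqq]
      · exact (hmono q q' hq' h hqq).le
    have hinj : InjOn G E := by
      intro q hq q' hq' h
      by_contra hqq
      rcases Separates.total hq hq' with h1 | h1
      · exact (hmono q q' hq' h1 hqq).ne h
      · exact (hmono q' q hq h1 (Ne.symm hqq)).ne h.symm
    have hlt : G p₀ < G p₁ := hmono p₀ p₁ h1E h0E hne
    have himage : ∀ c ∈ Icc (G p₀) (G p₁), ∃ q ∈ E, G q = c := by
      intro c hc
      obtain ⟨q, ⟨hqE, hqc⟩, hqmax⟩ := (hEc.inter_right (isClosed_le hG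
        (continuous_const (y := c)))).exists_isMaxOn ⟨p₀, h0E, hc.1⟩ hG.continuousOn
      obtain ⟨w, ⟨hwE, hwc⟩, hwmin⟩ := (hEc.inter_right (isClosed_le
        (continuous_const (y := c)) hG)).exists_isMinOn ⟨p₁, h1E, hc.2⟩ hG.continuousOn
      by_contra hcon
      push Not at hcon
      have hqc' : G q < c := lt_of_le_of_ne hqc (hcon q hqE)
      have hwc' : c < G w := lt_of_le_of_ne hwc (Ne.symm (hcon w hwE))
      have hqw : Separates q p₀ w := by
        rcases Separates.total hqE hwE with h | h
        · exact h
        · exact absurd (hle w q hqE h) (not_le.2 (hqc'.trans hwc'))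
      obtain ⟨r, hrq, hrw, hr⟩ := hB q w fun h => (hqc'.trans hwc').ne (congrArg G h)
      have hrE : r ∈ E := Separates.trans hqE hwE hr
      have h1 : G q < G r := by
        rcases Separates.total hqE hrE with h | h
        · exact hmono q r hrE h (Ne.symm hrq)
        · exact absurd h (hqw.not_separates_of_between hr hrq)
      have h2 : G r < G w := hmono r w hwE (hqw.trans (separates_right _ _) hr) hrw
      rcases le_total (G r) c with h | h
      · exact absurd (hqmax ⟨hrE, h⟩) (not_le.2 h1)
      · exact absurd (hwmin ⟨hrE, h⟩) (not_le.2 h2)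
    let g : E → Icc (G p₀) (G p₁) := fun q => ⟨G q.1, hle p₀ q q.2 (separates_left _ _),
      hle q p₁ h1E q.2⟩
    have hgc : Continuous g := (hG.comp continuous_subtype_val).subtype_mk _
    have hgb : Function.Bijective g := by
      refine ⟨fun q q' h => Subtype.ext (hinj q.2 q'.2 (congrArg Subtype.val h)), fun c => ?_⟩
      obtain ⟨q, hq, hqc⟩ := himage c.1 c.2
      exact ⟨⟨q, hq⟩, Subtype.ext hqc⟩
    let e : E ≃ₜ Icc (G p₀) (G p₁) := Continuous.homeoOfEquivCompactToT2
      (f := Equiv.ofBijective g hgb) hgc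
    let k : unitInterval ≃ₜ E := (iccHomeoI (G p₀) (G p₁) hlt).symm.trans e.symm
    have hk0 : k 0 = ⟨p₀, h0E⟩ := by
      apply k.symm.injective
      rw [k.symm_apply_apply]
      apply (iccHomeoI (G p₀) (G p₁) hlt).symm.injective
      refine Eq.trans ?_ ((iccHomeoI (G p₀) (G p₁) hlt).symm_apply_apply _).symm
      apply Subtype.ext
      rw [iccHomeoI_symm_apply_coe]
      simp [e, g]
      rfl
    have hk1 : k 1 = ⟨p₁, h1E⟩ := by
      apply k.symm.injective
      rw [k.symm_apply_apply]
      apply (iccHomeoI (G p₀) (G p₁) hlt).symm.injective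
      refine Eq.trans ?_ ((iccHomeoI (G p₀) (G p₁) hlt).symm_apply_apply _).symm
      apply Subtype.ext
      rw [iccHomeoI_symm_apply_coe]
      simp [e, g]
      rfl
    exact ⟨⟨⟨fun t => (k t).1, by fun_prop⟩, congrArg Subtype.val hk0, congrArg Subtype.val hk1⟩,
      IsEmbedding.subtypeVal.comp k.isEmbedding⟩
  · intro γ₁ γ₂ hγ₁ hγ₂ h0 h1
    have hne : γ₁ 0 ≠ γ₁ 1 := fun h => zero_ne_one (hγ₁ h)
    have : PathConnectedSpace T := ⟨⟨γ₁ 0⟩, fun p q => joinedIn_univ.1 (hpc p q)⟩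
    obtain ⟨G, hG, hmono⟩ := exists_strictMono_on_separators hA hB (γ₁ 0) (γ₁ 1)
    have hr₁ := range_eq_of_injective hB γ₁ hγ₁
    have hr₂ := range_eq_of_injective hB γ₂ hγ₂
    rw [← h0, ← h1] at hr₂
    have hlt : G (γ₁ 0) < G (γ₁ 1) := hmono _ _ (separates_right _ _) (separates_left _ _) hne
    have hinj : InjOn G {q | Separates q (γ₁ 0) (γ₁ 1)} := by
      intro q hq q' hq' h
      by_contra hqq
      rcases Separates.total hq hq' with h1 | h1
      · exact (hmono q q' hq' h1 hqq).ne h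
      · exact (hmono q' q hq h1 (Ne.symm hqq)).ne h.symm
    have hsm : ∀ γ : C(unitInterval, T), Function.Injective γ → γ 0 = γ₁ 0 → γ 1 = γ₁ 1 →
        range γ = {q | Separates q (γ₁ 0) (γ₁ 1)} → StrictMono (G ∘ γ) := by
      intro γ hγ e0 e1 hr
      have hinj' : Function.Injective (G ∘ γ) := fun s t hst =>
        hγ (hinj (hr ▸ mem_range_self s) (hr ▸ mem_range_self t) hst)
      rcases (hG.comp γ.continuous).strictMono_of_inj hinj' with h | h
      · exact h
      · have := h (zero_lt_one : (0 : unitInterval) < 1)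
        simp only [Function.comp_apply, e0, e1] at this
        exact absurd this hlt.not_gt
    have hs₁ := hsm γ₁ hγ₁ rfl rfl hr₁
    have hs₂ := hsm γ₂ hγ₂ h0.symm h1.symm hr₂
    have hex : ∀ t, ∃ s, γ₂ s = γ₁ t := fun t => by
      have : γ₁ t ∈ range γ₂ := by rw [hr₂, ← hr₁]; exact mem_range_self t
      exact this
    choose τ hτ using hex
    have hτm : StrictMono τ := by
      intro s t hst
      rw [← hs₂.lt_iff_lt]
      simp only [Function.comp_apply, hτ]
      exact hs₁ hst
    have hτs : Function.Surjective τ := by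
      intro s
      have : γ₂ s ∈ range γ₁ := by rw [hr₁, ← hr₂]; exact mem_range_self s
      obtain ⟨t, ht⟩ := this
      exact ⟨t, hγ₂ ((hτ t).trans ht)⟩
    exact ⟨hτm.orderIsoOfSurjective τ hτs, fun t => (hτ t).symm⟩

end Metric

section Factorization

variable {X T : Type u} {Y : Type v} [MetricSpace X] [MetricSpace T] [MetricSpace Y]

/-- Paths avoiding a point in the target of `ψ` can be lifted to paths avoiding its fiber. -/
theorem joinedIn_compl_preimage [LocallyPathConnectedSpace X] {ψ : X → T}
    (hsurj : Function.Surjective ψ)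
    (hloc : ∀ (x x' : X) (ε : ℝ), dist (ψ x) (ψ x') < ε →
      JoinedIn (ψ ⁻¹' Metric.ball (ψ x) ε) x x')
    {p : T} {x x' : X} (h : JoinedIn {p}ᶜ (ψ x) (ψ x')) : JoinedIn (ψ ⁻¹' {p})ᶜ x x' := by
  set O : Set X := (ψ ⁻¹' {p})ᶜ
  set P : Set X := pathComponentIn O x
  have hx : x ∈ P := mem_pathComponentIn_self h.source_mem
  have hstep : ∀ z z', z ∈ O → dist (ψ z) (ψ z') < dist (ψ z) p → JoinedIn O z z' := by
    intro z z' _ hd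
    refine (hloc z z' _ hd).mono fun w hw hwp => ?_
    have hw' : dist (ψ w) (ψ z) < dist (ψ z) p := hw
    rw [show ψ w = p from hwp, dist_comm] at hw'
    exact lt_irrefl _ hw'
  have hpos : ∀ z, z ∈ O → 0 < dist (ψ z) p := fun z hz => dist_pos.2 hz
  have hopen : ∀ Q : Set X, Q ⊆ O → (∀ z ∈ Q, ∀ z', JoinedIn O z z' → z' ∈ Q) →
      IsOpen (ψ '' Q) := by
    intro Q hQO hQ
    rw [isOpen_iff_mem_nhds]
    rintro _ ⟨z, hz, rfl⟩
    filter_upwards [Metric.ball_mem_nhds (ψ z) (hpos z (hQO hz))] with q hq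
    obtain ⟨z', rfl⟩ := hsurj q
    rw [Metric.mem_ball, dist_comm] at hq
    exact ⟨z', hQ z hz z' (hstep z z' (hQO hz) hq), rfl⟩
  obtain ⟨γ, hγ⟩ := h
  have hsub := (isPreconnected_range γ.continuous).subset_left_of_subset_union
    (u := ψ '' P) (v := ψ '' (O \ P))
    (hopen P pathComponentIn_subset fun z hz z' hzz' => JoinedIn.trans hz hzz')
    (hopen (O \ P) sdiff_subset fun z hz z' hzz' =>
      ⟨hzz'.target_mem, fun h' => hz.2 (JoinedIn.trans h' hzz'.symm)⟩)
    (by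
      rw [disjoint_left]
      rintro _ ⟨z, hz, rfl⟩ ⟨z', hz', hzz'⟩
      have hzO : z ∈ O := JoinedIn.target_mem hz
      exact hz'.2 (JoinedIn.trans hz (hstep z z' hzO (by rw [hzz', dist_self]; exact hpos z hzO))))
    (by
      rintro _ ⟨t, rfl⟩
      obtain ⟨z, hz⟩ := hsurj (γ t)
      have hzO : z ∈ O := fun h' => hγ t (hz.symm.trans h')
      by_cases hzP : z ∈ P
      · exact Or.inl ⟨z, hzP, hz⟩
      · exact Or.inr ⟨z, ⟨hzO, hzP⟩, hz⟩)
    ⟨ψ x, mem_range.2 ⟨0, γ.source⟩, mem_image_of_mem _ hx⟩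
  obtain ⟨z, hz, hzx'⟩ := hsub (mem_range.2 ⟨1, γ.target⟩)
  have hzO : z ∈ O := JoinedIn.target_mem hz
  exact JoinedIn.trans hz (hstep z x' hzO (by rw [hzx', dist_self, ← hzx']; exact hpos z hzO))

/-- Property (T) passes to the factor: points with different values are separated by a point with
a third value. -/
theorem exists_separates_of_ne [LocallyPathConnectedSpace X] [PathConnectedSpace X]
    (hlift : ∀ g : C(X, AddCircle (1 : ℝ)), ∃ G : C(X, ℝ), ∀ x, (G x : AddCircle (1 : ℝ)) = g x)
    {ψ : X → T} (hψ : Continuous ψ) (hsurj : Function.Surjective ψ)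
    (hloc : ∀ (x x' : X) (ε : ℝ), dist (ψ x) (ψ x') < ε →
      JoinedIn (ψ ⁻¹' Metric.ball (ψ x) ε) x x')
    {f : T → Y} (hf : Continuous f) (hT : PropertyT (f ∘ ψ))
    (hdiam : ∀ (A : Set X) (y : Y) (ε : ℝ), IsConnected A → (∀ z ∈ A, dist (f (ψ z)) y ≤ ε) →
      ∀ x ∈ A, ∀ x' ∈ A, dist (ψ x) (ψ x') ≤ 2 * ε)
    {p q : T} (hpq : f p ≠ f q) : ∃ r, f r ≠ f p ∧ f r ≠ f q ∧ Separates r p q := by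
  obtain ⟨x, rfl⟩ := hsurj p
  obtain ⟨x', rfl⟩ := hsurj q
  obtain ⟨y, hyx, hyx', hy⟩ := hT x x' hpq
  have hF : IsClosed ((f ∘ ψ) ⁻¹' {y}) := isClosed_singleton.preimage (hf.comp hψ)
  have hsep : ¬ JoinedIn ((f ∘ ψ) ⁻¹' {y})ᶜ x x' := by
    rintro ⟨γ, hγ⟩
    obtain ⟨t, ht⟩ := hy γ
    exact hγ t ht
  obtain ⟨K, hKF, hK, hKsep⟩ := exists_isConnected_separator hlift hF hsep
  obtain ⟨k, hk⟩ := hK.nonempty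
  have hfk : f (ψ k) = y := hKF hk
  have hconst : ∀ z ∈ K, ψ z = ψ k := by
    intro z hz
    have := hdiam K y 0 hK (fun w hw => by
      rw [show f (ψ w) = y from hKF hw, dist_self]) z hz k hk
    rw [mul_zero] at this
    exact dist_le_zero.1 this
  refine ⟨ψ k, by rw [hfk]; exact hyx, by rw [hfk]; exact hyx', fun h => hKsep ?_⟩
  refine (joinedIn_compl_preimage hsurj hloc h).mono fun z hz hzK => hz (hconst z hzK)

/-- The separating points take all intermediate distances. -/
theorem exists_separates_dist_eq {f : T → Y} (hf : Continuous f)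
    (hne : ∀ p q : T, f p ≠ f q → ∃ r, f r ≠ f p ∧ f r ≠ f q ∧ Separates r p q)
    {p q : T} (γ : Path p q) {c : ℝ} (hc : 0 ≤ c) (hc' : c ≤ dist (f q) (f p)) :
    ∃ r, Separates r p q ∧ dist (f r) (f p) = c := by
  by_contra hcon
  push Not at hcon
  have hS : IsClosed (γ ⁻¹' {r | Separates r p q}) :=
    (isClosed_setOf_separates _ _).preimage γ.continuous
  have hh : Continuous fun t => dist (f (γ t)) (f p) :=
    (hf.comp γ.continuous).dist continuous_const
  obtain ⟨w, ⟨hwS, hwc⟩, hwmin⟩ := (hS.inter (isClosed_le (continuous_const (y := c)) hh)).isCompact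
    |>.exists_isLeast ⟨1, by simpa using separates_right p q, by simpa using hc'⟩
  obtain ⟨s, ⟨⟨hsS, hsc⟩, hsw⟩, hsmax⟩ := ((hS.inter (isClosed_le hh
    (continuous_const (y := c)))).inter isClosed_Iic).isCompact.exists_isGreatest
    ⟨0, ⟨by simpa using separates_left p q, by simpa using hc⟩,
      (unitInterval.nonneg' : (0 : unitInterval) ≤ w)⟩
  simp only [mem_ofPred_eq] at hwc hsc
  have hlt : dist (f (γ s)) (f p) < dist (f (γ w)) (f p) :=
    (lt_of_le_of_ne hsc (hcon _ hsS)).trans_le hwc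
  obtain ⟨r, hrs, hrw, hr⟩ := hne (γ s) (γ w) fun h => by rw [h] at hlt; exact lt_irrefl _ hlt
  obtain ⟨hrS, u, hu, rfl⟩ := Separates.exists_mem_Ioo γ hsw hsS hwS hr
    (fun h => hrs (congrArg f h)) (fun h => hrw (congrArg f h))
  rcases le_total (dist (f (γ u)) (f p)) c with h | h
  · exact absurd (hsmax ⟨⟨hrS, h⟩, hu.2.le⟩) (not_le.2 hu.1)
  · exact absurd (hwmin ⟨hrS, h⟩) (not_le.2 hu.2)

theorem isTree_of_factorization [LocallyPathConnectedSpace X] [PathConnectedSpace X]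
    (hlift : ∀ g : C(X, AddCircle (1 : ℝ)), ∃ G : C(X, ℝ), ∀ x, (G x : AddCircle (1 : ℝ)) = g x)
    {ψ : X → T} (hψ : Continuous ψ) (hsurj : Function.Surjective ψ)
    (hloc : ∀ (x x' : X) (ε : ℝ), dist (ψ x) (ψ x') < ε →
      JoinedIn (ψ ⁻¹' Metric.ball (ψ x) ε) x x')
    {f : T → Y} (hf : Continuous f) (hT : PropertyT (f ∘ ψ))
    (hdiam : ∀ (A : Set X) (y : Y) (ε : ℝ), IsConnected A → (∀ z ∈ A, dist (f (ψ z)) y ≤ ε) →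
      ∀ x ∈ A, ∀ x' ∈ A, dist (ψ x) (ψ x') ≤ 2 * ε) :
    IsTree T := by
  have hne : ∀ p q : T, f p ≠ f q → ∃ r, f r ≠ f p ∧ f r ≠ f q ∧ Separates r p q := fun p q h =>
    exists_separates_of_ne hlift hψ hsurj hloc hf hT hdiam h
  have hmap : ∀ {p : T} {z z' : X}, JoinedIn (ψ ⁻¹' {p})ᶜ z z' → JoinedIn {p}ᶜ (ψ z) (ψ z') := by
    rintro p z z' ⟨γ, hγ⟩
    exact ⟨γ.map hψ, fun t => hγ t⟩
  refine isTree_of_separates (fun p q r hpq => ?_) fun p q hpq => ?_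
  · obtain ⟨x, rfl⟩ := hsurj p
    obtain ⟨x', rfl⟩ := hsurj q
    obtain ⟨γ, hγ⟩ := hloc x x' r hpq
    exact ⟨γ.map hψ, fun t => hγ t⟩
  by_cases hfpq : f p = f q
  swap
  · obtain ⟨r, hrp, hrq, hr⟩ := hne p q hfpq
    exact ⟨r, fun h => hrp (congrArg f h), fun h => hrq (congrArg f h), hr⟩
  obtain ⟨x, rfl⟩ := hsurj p
  obtain ⟨x', rfl⟩ := hsurj q
  set h : X → ℝ := fun z => dist (f (ψ z)) (f (ψ x)) with hh
  have hhc : Continuous h := (hf.comp hψ).dist continuous_const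
  have hδ : 0 < dist (ψ x) (ψ x') := dist_pos.2 hpq
  set ε := dist (ψ x) (ψ x') / 3 with hε
  have hε0 : 0 < ε := by positivity
  have hF : IsClosed (h ⁻¹' {ε}) := isClosed_singleton.preimage hhc
  have hsep : ¬ JoinedIn (h ⁻¹' {ε})ᶜ x x' := by
    rintro ⟨γ, hγ⟩
    have hlt : ∀ t, h (γ t) < ε := by
      intro t
      by_contra hcon
      have hivt := intermediate_value_univ 0 t (hhc.comp γ.continuous)
      have h0 : (h ∘ γ) 0 = 0 := by simp [hh]
      rw [h0] at hivt
      obtain ⟨s, hs⟩ := hivt ⟨hε0.le, not_lt.1 hcon⟩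
      exact hγ s hs
    have := hdiam (range γ) (f (ψ x)) ε (isConnected_range γ.continuous)
      (by rintro _ ⟨t, rfl⟩; exact (hlt t).le) x (mem_range.2 ⟨0, γ.source⟩) x'
      (mem_range.2 ⟨1, γ.target⟩)
    linarith
  obtain ⟨K, hKF, hK, hKsep⟩ := exists_isConnected_separator hlift hF hsep
  obtain ⟨k, hk⟩ := hK.nonempty
  have hhk : h k = ε := hKF hk
  obtain ⟨r, hr, hrε⟩ := exists_separates_dist_eq hf hne
    ((PathConnectedSpace.joined x k).somePath.map hψ) (c := ε / 2) (by positivity)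
    (by change ε / 2 ≤ h k; rw [hhk]; linarith)
  have hr0 : f r ≠ f (ψ x) := fun h' => by rw [h', dist_self] at hrε; linarith
  refine ⟨r, fun h' => hr0 (congrArg f h'), fun h' => hr0 ((congrArg f h').trans hfpq.symm),
    fun hJ => hr ?_⟩
  obtain ⟨γ, hγ⟩ := joinedIn_compl_preimage hsurj hloc hJ
  obtain ⟨t, ht⟩ : ∃ t, γ t ∈ K := by
    by_contra hcon
    push Not at hcon
    exact hKsep ⟨γ, hcon⟩
  have h1 : JoinedIn (ψ ⁻¹' {r})ᶜ x (γ t) := by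
    have := joinedIn_image_Icc γ (unitInterval.nonneg' : (0 : unitInterval) ≤ t)
    rw [γ.source] at this
    exact this.mono (image_subset_iff.2 fun s _ => hγ s)
  have h2 : JoinedIn (ψ ⁻¹' {r})ᶜ (γ t) k := by
    refine joinedIn_of_isPreconnected hK.isPreconnected
      (isClosed_singleton.preimage hψ).isOpen_compl (fun z hz hzr => ?_) ht hk
    have hhz : h z = ε := hKF hz
    have : h z = ε / 2 := by rw [← hrε, ← show ψ z = r from hzr]
    linarith
  exact hmap (h1.trans h2)

end Factorization

section TreeMetric

variable {X : Type u} {Y : Type v} [MetricSpace X] [MetricSpace Y] {φ : X → Y}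

theorem edist_le_treeDist (φ : X → Y) (x x' : X) : edist (φ x) (φ x') ≤ treeDist φ x x' :=
  le_iInf₂ fun _ hA => Metric.edist_le_ediam_of_mem (mem_image_of_mem _ hA.2.1)
    (mem_image_of_mem _ hA.2.2)

theorem treeDist_le {A : Set X} (hA : IsConnected A) {x x' : X} (hx : x ∈ A) (hx' : x' ∈ A) :
    treeDist φ x x' ≤ Metric.ediam (φ '' A) :=
  iInf₂_le A ⟨hA, hx, hx'⟩

theorem treeDist_ne_top [PathConnectedSpace X] (hφ : Continuous φ) (x x' : X) :
    treeDist φ x x' ≠ ∞ := by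
  obtain ⟨γ⟩ := PathConnectedSpace.joined x x'
  refine ne_top_of_le_ne_top ?_ (treeDist_le (isConnected_range γ.continuous)
    (mem_range.2 ⟨0, γ.source⟩) (mem_range.2 ⟨1, γ.target⟩))
  exact ((isCompact_range γ.continuous).image hφ).isBounded.ediam_ne_top

/-- The metric of the quotient `T = X/∼`. -/
@[reducible] noncomputable def treeMetricSpace (φ : X → Y) (hfin : ∀ x x', treeDist φ x x' ≠ ∞) :
    MetricSpace (TreeQuotient φ) where
  dist := Quotient.lift₂ (fun x x' => (treeDist φ x x').toReal) (by
    have key : ∀ a b a' b' : X, treeDist φ a a' = 0 → treeDist φ b b' = 0 →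
        treeDist φ a b ≤ treeDist φ a' b' := by
      intro a b a' b' ha hb
      calc treeDist φ a b ≤ treeDist φ a a' + treeDist φ a' b := treeDist_triangle _ _ _ _
        _ ≤ treeDist φ a a' + (treeDist φ a' b' + treeDist φ b' b) := by
          gcongr; exact treeDist_triangle _ _ _ _
        _ = treeDist φ a' b' := by rw [ha, treeDist_comm φ b' b, hb, zero_add, add_zero]
    intro a b a' b' ha hb
    refine congrArg ENNReal.toReal (le_antisymm (key _ _ _ _ ha hb) (key _ _ _ _ ?_ ?_))
    · rw [treeDist_comm]; exact ha
    · rw [treeDist_comm]; exact hb)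
  dist_self p := by
    induction p using Quotient.inductionOn with
    | h x => simp [treeDist_self]
  dist_comm p q := by
    induction p, q using Quotient.inductionOn₂ with
    | h x y => simp [treeDist_comm φ x y]
  dist_triangle p q r := by
    induction p, q, r using Quotient.inductionOn₃ with
    | h x y z =>
      simp only [Quotient.lift_mk]
      rw [← ENNReal.toReal_add (hfin _ _) (hfin _ _)]
      exact ENNReal.toReal_mono (ENNReal.add_ne_top.2 ⟨hfin _ _, hfin _ _⟩)
        (treeDist_triangle _ _ _ _)
  eq_of_dist_eq_zero {p q} h := by
    induction p, q using Quotient.inductionOn₂ with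
    | h x y =>
      refine Quotient.sound ?_
      rcases (ENNReal.toReal_eq_zero_iff _).1 h with h | h
      · exact h
      · exact absurd h (hfin _ _)

theorem joinedIn_of_treeDist_lt [LocallyPathConnectedSpace X] (hφ : Continuous φ) {x x' : X}
    {ε : ℝ≥0∞} (h : treeDist φ x x' < ε) : JoinedIn {z | treeDist φ x z < ε} x x' := by
  simp only [treeDist, iInf_lt_iff] at h
  obtain ⟨A, ⟨hA, hx, hx'⟩, hlt⟩ := h
  obtain ⟨δ, hδ, hδε⟩ := ENNReal.lt_iff_exists_add_pos_lt.1 hlt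
  set η : ℝ≥0 := δ / 2 with hη
  have hη0 : 0 < η := by positivity
  have hopen : IsOpen (φ ⁻¹' Metric.thickening η (φ '' A)) := Metric.isOpen_thickening.preimage hφ
  obtain ⟨γ, hγ⟩ := joinedIn_of_isPreconnected hA.isPreconnected hopen
    (fun z hz => Metric.self_subset_thickening (by exact_mod_cast hη0) _ (mem_image_of_mem _ hz))
    hx hx'
  refine ⟨γ, fun t => ?_⟩
  refine (treeDist_le (isConnected_range γ.continuous) (mem_range.2 ⟨0, γ.source⟩)
    (mem_range_self t)).trans_lt (lt_of_le_of_lt ?_ hδε)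
  calc Metric.ediam (φ '' range γ) ≤ Metric.ediam (Metric.thickening η (φ '' A)) := by
        refine Metric.ediam_mono (image_subset_iff.2 (range_subset_iff.2 hγ))
    _ ≤ Metric.ediam (φ '' A) + 2 * η := Metric.ediam_thickening_le η
    _ = Metric.ediam (φ '' A) + δ := by
        congr 1
        rw [hη]
        norm_cast
        rw [mul_div_cancel₀ _ (two_ne_zero)]

theorem eventually_treeDist_lt [LocallyPathConnectedSpace X] (hφ : Continuous φ) (x : X)
    {ε : ℝ≥0∞} (hε : 0 < ε) : ∀ᶠ z in 𝓝 x, treeDist φ x z < ε := by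
  obtain ⟨δ, hδ, hδε⟩ := ENNReal.lt_iff_exists_nnreal_btwn.1 hε
  set η : ℝ≥0 := δ / 2 with hη
  have hη0 : 0 < (η : ℝ≥0∞) := by
    have : 0 < δ := by exact_mod_cast hδ
    have : 0 < η := by positivity
    exact_mod_cast this
  have hU : φ ⁻¹' Metric.eball (φ x) η ∈ 𝓝 x :=
    hφ.continuousAt.preimage_mem_nhds (Metric.eball_mem_nhds _ hη0)
  filter_upwards [pathComponentIn_mem_nhds hU] with z hz
  obtain ⟨γ, hγ⟩ := hz
  refine (treeDist_le (isConnected_range γ.continuous) (mem_range.2 ⟨0, γ.source⟩)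
    (mem_range.2 ⟨1, γ.target⟩)).trans_lt (lt_of_le_of_lt ?_ hδε)
  calc Metric.ediam (φ '' range γ) ≤ Metric.ediam (Metric.eball (φ x) η) := by
        refine Metric.ediam_mono (image_subset_iff.2 (range_subset_iff.2 hγ))
    _ ≤ 2 * η := Metric.ediam_eball_le
    _ = δ := by
        rw [hη]
        norm_cast
        rw [mul_div_cancel₀ _ (two_ne_zero)]

end TreeMetric

theorem IsSigmaContinuous.continuous {σ : ℝ≥0 → ℝ≥0} (hσ : IsModulus σ) {X : Type u} {Y : Type v}
    [MetricSpace X] [MetricSpace Y] {φ : X → Y} (hφ : IsSigmaContinuous σ φ) : Continuous φ := by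
  rw [continuous_iff_continuousAt]
  intro x
  rw [ContinuousAt, tendsto_iff_dist_tendsto_zero]
  have hlim : Filter.Tendsto (fun z => ((σ (nndist z x) : ℝ≥0) : ℝ)) (𝓝 x) (𝓝 0) := by
    have hc : Continuous fun z => ((σ (nndist z x) : ℝ≥0) : ℝ) :=
      NNReal.continuous_coe.comp (hσ.continuous.comp (continuous_id.nndist continuous_const))
    simpa [hσ.map_zero] using hc.tendsto x
  exact squeeze_zero (fun _ => dist_nonneg) (fun z => by exact_mod_cast hφ z x) hlim

end FactorTree

open FactorTree in
theorem mainTheorem6 {X : Type u} {Y : Type v} [MetricSpace X] [MetricSpace Y]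
    (C : ℝ) (hX : FactorTree.IsQuasiConvex C X)
    (hH : FactorTree.SingularH1Vanishes X ∨ FactorTree.LipschitzH1Vanishes X)
    (σ : ℝ≥0 → ℝ≥0) (hσ : FactorTree.IsModulus σ)
    (φ : X → Y) (hφ : FactorTree.IsSigmaContinuous σ φ) (hT : FactorTree.PropertyT φ) :
    ∃ D : MetricSpace (FactorTree.TreeQuotient φ),
      (∀ x x' : X, ENNReal.ofReal (D.dist (FactorTree.treeProj φ x) (FactorTree.treeProj φ x')) =
        FactorTree.treeDist φ x x') ∧
      FactorTree.IsTree (FactorTree.TreeQuotient φ) := by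
  have hφc : Continuous φ := hφ.continuous hσ
  have hjoined : ∀ x x' : X, Joined x x' := fun x x' => ⟨(hX x x').choose⟩
  have hfin : ∀ x x', treeDist φ x x' ≠ ∞ := fun x x' => by
    have : PathConnectedSpace X := ⟨⟨x⟩, hjoined⟩
    exact treeDist_ne_top hφc x x'
  let _ := treeMetricSpace φ hfin
  have hdist : ∀ x x', dist (treeProj φ x) (treeProj φ x') = (treeDist φ x x').toReal :=
    fun _ _ => rfl
  refine ⟨treeMetricSpace φ hfin, fun x x' => ENNReal.ofReal_toReal (hfin x x'), ?_⟩
  have hsurj : Function.Surjective (treeProj φ) := Quotient.mk_surjective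
  rcases isEmpty_or_nonempty X with hemp | hne
  · have hempT : IsEmpty (TreeQuotient φ) := hsurj.isEmpty
    exact ⟨fun p => isEmptyElim p, fun γ => isEmptyElim (γ 0)⟩
  have : PathConnectedSpace X := ⟨hne, hjoined⟩
  have : LocallyPathConnectedSpace X := hX.locallyPathConnectedSpace
  let f : TreeQuotient φ → Y := Quotient.lift φ fun x x' h => by
    have h' : treeDist φ x x' = 0 := h
    exact edist_le_zero.1 ((edist_le_treeDist φ x x').trans h'.le)
  have hf : Continuous f := by
    refine LipschitzWith.continuous (K := 1) (LipschitzWith.of_dist_le_mul fun p q => ?_)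
    obtain ⟨x, rfl⟩ := hsurj p
    obtain ⟨x', rfl⟩ := hsurj q
    rw [NNReal.coe_one, one_mul, hdist, dist_edist]
    exact ENNReal.toReal_mono (hfin x x') (edist_le_treeDist φ x x')
  have hlt : ∀ (x x' : X) (ε : ℝ), dist (treeProj φ x) (treeProj φ x') < ε ↔
      treeDist φ x x' < ENNReal.ofReal ε := by
    intro x x' ε
    rw [hdist, ENNReal.lt_ofReal_iff_toReal_lt (hfin x x')]
  refine isTree_of_factorization (fun g => hX.exists_lift hH g) (ψ := treeProj φ) (f := f) ?_ hsurj
    ?_ hf hT ?_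
  · rw [continuous_iff_continuousAt]
    intro x
    rw [ContinuousAt, Metric.tendsto_nhds]
    intro ε hε
    filter_upwards [eventually_treeDist_lt hφc x (ENNReal.ofReal_pos.2 hε)] with z hz
    rw [dist_comm]
    exact (hlt x z ε).2 hz
  · intro x x' ε h
    refine (joinedIn_of_treeDist_lt hφc ((hlt x x' ε).1 h)).mono fun z hz => ?_
    rw [mem_preimage, Metric.mem_ball, dist_comm]
    exact (hlt x z ε).2 hz
  · intro A y ε hA hAy x hx x' hx'
    have hε : 0 ≤ ε := dist_nonneg.trans (hAy x hx)
    rw [hdist]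
    refine ENNReal.toReal_le_of_le_ofReal (by positivity) ((treeDist_le hA hx hx').trans ?_)
    refine Metric.ediam_le ?_
    rintro _ ⟨z, hz, rfl⟩ _ ⟨z', hz', rfl⟩
    rw [edist_dist]
    refine ENNReal.ofReal_le_ofReal ((dist_triangle_right _ _ y).trans ?_)
    have h1 : dist (φ z) y ≤ ε := hAy z hz
    have h2 : dist (φ z') y ≤ ε := hAy z' hz'
    linarith
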